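/- Let $\ell$ be a prime, $E$ a finite field extension of $\mathbb{Q}_\ell$ with its $\ell$-adic topology, $G$ a profinite group, $H\subset G$ a closed normal subgroup and $\Gamma=G/H$. The group $\Gamma$ acts on the set of isomorphism classes of continuous representations $H\to \mathrm{GL}_r(E)$ by conjugation with lifts of its elements to $G$. Let $\rho_H\colon H\to \mathrm{GL}_r(E)$ be a continuous representation which is absolutely simple (that is, simple after extension of scalars to an algebraic closure of $E$), whose determinant $\det\rho_H$ has finite image, and whose isomorphism class $[\rho_H]$ is fixed by $\Gamma$. Then: (existence) there are an open subgroup $G'\subset G$ with $H\subset G'$ and a continuous representation $\rho\colon G'\to \mathrm{GL}_r(E)$ such that $\rho|_H=\rho_H$ and $\det\rho$ has finite image; (essential uniqueness) if $G_1,G_2\subset G$ are open subgroups containing $H$ and $\rho_i\colon G_i\to \mathrm{GL}_r(E)$ $(i=1,2)$ are continuous representations with $\rho_i|_H=\rho_H$ and $\det\rho_i$ of finite image, then there is an open subgroup $G_3\subset G_1\cap G_2$ with $H\subset G_3$ and $\rho_1|_{G_3}=\rho_2|_{G_3}$. -/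

import Mathlib

namespace ProfiniteExt

/-- Continuous representations `H → GL_r(E)`; `GL_r(E)` carries its usual topology as the unit
group of the topological ring of `r × r` matrices. -/
abbrev ContRep (H : Type*) [Group H] [TopologicalSpace H] (r : ℕ) (E : Type*) [Field E]
    [TopologicalSpace E] :=
  H →ₜ* Matrix.GeneralLinearGroup (Fin r) E

section Rep

variable {H : Type*} [Group H] {r : ℕ} {E : Type*} [Field E]

/-- The linear representation on column vectors `E^r` given by a matrix representation. -/
def toRepresentation (ρ : H →* Matrix.GeneralLinearGroup (Fin r) E) :
    Representation E H (Fin r → E) :=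
  ((Matrix.toLinAlgEquiv' : Matrix (Fin r) (Fin r) E ≃ₐ[E] _) : _ →* _).comp
    ((Units.coeHom (Matrix (Fin r) (Fin r) E)).comp ρ)

/-- A matrix representation over `E` is absolutely simple if it is simple after extension of
scalars to an algebraic closure of `E`. -/
def IsAbsolutelySimple (ρ : H →* Matrix.GeneralLinearGroup (Fin r) E) : Prop :=
  (toRepresentation
    ((Matrix.GeneralLinearGroup.map (algebraMap E (AlgebraicClosure E))).comp ρ)).IsIrreducible

/-- The determinant character of the representation has finite image. -/
def HasFiniteDet (ρ : H →* Matrix.GeneralLinearGroup (Fin r) E) : Prop :=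
  (Set.range fun h => Matrix.GeneralLinearGroup.det (ρ h)).Finite

end Rep

section IsoClass

variable (H : Type*) [Group H] [TopologicalSpace H] (r : ℕ) (E : Type*) [Field E]
  [TopologicalSpace E]

/-- Isomorphism of continuous matrix representations: conjugacy by an element of `GL_r(E)`. -/
def isoSetoid : Setoid (ContRep H r E) where
  r ρ σ := ∃ W : Matrix.GeneralLinearGroup (Fin r) E, ∀ h, σ h = W * ρ h * W⁻¹
  iseqv :=
    { refl := fun ρ => ⟨1, fun h => by simp⟩
      symm := by
        rintro ρ σ ⟨W, hW⟩
        exact ⟨W⁻¹, fun h => by rw [hW h]; group⟩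
      trans := by
        rintro ρ σ τ ⟨W, hW⟩ ⟨W', hW'⟩
        exact ⟨W' * W, fun h => by rw [hW' h, hW h]; group⟩ }

/-- The set of isomorphism classes of continuous representations `H → GL_r(E)`. -/
def IsoClass : Type _ := Quotient (isoSetoid H r E)

variable {H r E}

/-- The isomorphism class `[ρ]`. -/
def isoClass (ρ : ContRep H r E) : IsoClass H r E := Quotient.mk (isoSetoid H r E) ρ

end IsoClass

section Action

variable {G : Type*} [Group G] [TopologicalSpace G] [IsTopologicalGroup G]
  (H : Subgroup G) [H.Normal] (r : ℕ) (E : Type*) [Field E] [TopologicalSpace E]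

variable {r E} in
/-- The conjugate representation `h ↦ ρ (g⁻¹ h g)` of the normal subgroup `H`. -/
def conjRep (g : G) (ρ : ContRep H r E) : ContRep H r E where
  toMonoidHom := ρ.toMonoidHom.comp (MulAut.conjNormal g⁻¹ : MulAut H).toMonoidHom
  continuous_toFun := by
    refine ρ.continuous_toFun.comp ?_
    refine Continuous.subtype_mk (f := fun h : H => g⁻¹ * (h : G) * (g⁻¹)⁻¹) ?_ _
    fun_prop

/-- The action of `G` on isomorphism classes of continuous representations of `H` by
conjugation. -/
@[reducible]
def conjAction : MulAction G (IsoClass H r E) where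
  smul g := Quotient.map (sa := isoSetoid H r E) (sb := isoSetoid H r E) (conjRep H g)
    (by
      rintro ρ σ ⟨W, hW⟩
      exact ⟨W, fun h => hW _⟩)
  one_smul := by
    rintro ⟨ρ⟩
    refine Quotient.sound (s := isoSetoid H r E) ⟨1, fun h => ?_⟩
    change ρ h = 1 * ρ (MulAut.conjNormal (1 : G)⁻¹ h) * 1⁻¹
    simp
  mul_smul := by
    rintro g g' ⟨ρ⟩
    refine Quotient.sound (s := isoSetoid H r E) ⟨1, fun h => ?_⟩
    change ρ (MulAut.conjNormal g'⁻¹ (MulAut.conjNormal g⁻¹ h)) =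
      1 * ρ (MulAut.conjNormal (g * g')⁻¹ h) * 1⁻¹
    simp

/-- Conjugation by elements of `H` itself does not change the isomorphism class. -/
theorem le_ker_conjAction :
    H ≤ (@MulAction.toPermHom G (IsoClass H r E) _ (conjAction H r E)).ker := by
  intro g hg
  rw [MonoidHom.mem_ker]
  ext ⟨ρ⟩
  refine Quotient.sound (s := isoSetoid H r E) ⟨ρ ⟨g, hg⟩, fun h => ?_⟩
  change ρ h = ρ ⟨g, hg⟩ * ρ (MulAut.conjNormal g⁻¹ h) * (ρ ⟨g, hg⟩)⁻¹
  rw [← map_inv, ← map_mul, ← map_mul]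
  congr 1
  ext
  simp [mul_assoc]

/-- The action of `Γ = G ⧸ H` on isomorphism classes of continuous representations of `H`, by
conjugation with lifts to `G`. -/
def quotientAction : G ⧸ H →* Equiv.Perm (IsoClass H r E) :=
  QuotientGroup.lift H (@MulAction.toPermHom G (IsoClass H r E) _ (conjAction H r E))
    (le_ker_conjAction H r E)

variable {H r E}

/-- `ρ` is a continuous extension, with finite determinant, of the representation `ρH` of `H` to
the subgroup `G'` containing `H`. -/
def IsFiniteDetExtension (ρH : ContRep H r E) (G' : Subgroup G) (hG' : H ≤ G')
    (ρ : ContRep G' r E) : Prop :=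
  (∀ h : H, ρ (Subgroup.inclusion hG' h) = ρH h) ∧ HasFiniteDet ρ.toMonoidHom

end Action

end ProfiniteExt

/-!
Absolute simplicity enters through Burnside's theorem: the matrices `ρH h` span `M_r(E)`
(`IsAbsolutelySimple.span_eq_top`). Hence two invertible matrices conjugating `ρH` in the same way
differ by a scalar (`exists_mul_inv_eq_scalar`), and if both have determinant a root of unity of
bounded order, then so is that scalar. Only finitely many such scalars exist, so near the identity
the scalar is `1` (`eventually_eq_one_of_scalar`).

Essential uniqueness follows: two extensions with finite determinant intertwine the same conjugates
of `ρH`, so they coincide near `1`, and the subgroup on which they coincide is open and contains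
`H`.

For existence, invariance of the isomorphism class of `ρH` provides for each `g` an intertwiner from
`ρH` to its conjugate by `g`. Writing matrix units as combinations of the `ρH h` gives a formula for
a scalar multiple of it that is continuous in `g` and equal to `1` at `g = 1`
(`sum_conj_mul_single_eq_smul`); dividing by an `r`-th root of its determinant, which is continuous
near `1` by the inverse function theorem, gives intertwiners `s g` of determinant `1`
(`exists_local_intertwiner`). By the rigidity above, on a small open subgroup `U` the map `s` is
multiplicative and agrees with `ρH` on `U ∩ H`, so that `u * h ↦ s u * ρH h` is the required
extension to the open subgroup `U * H` (`exists_monoidHom_sup`).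
-/

namespace ProfiniteExt

open Filter Topology Matrix

/-! ### Spanning and Schur's lemma -/

section Span

/-- **Burnside's theorem**: the operators of an irreducible finite-dimensional representation over
an algebraically closed field span the whole endomorphism algebra. By Schur's lemma every linear
endomorphism commutes with the endomorphisms of the module, so the Jacobson density theorem
applies. -/
theorem span_range_eq_top_of_isIrreducible {K V H : Type*} [Field K] [IsAlgClosed K]
    [AddCommGroup V] [Module K V] [FiniteDimensional K V] [Group H] (ρ : Representation K H V)
    [ρ.IsIrreducible] : Submodule.span K (Set.range ρ) = ⊤ := by
  rw [eq_top_iff]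
  rintro f -
  have schur := IsSimpleModule.algebraMap_end_bijective_of_isAlgClosed (A := MonoidAlgebra K H)
    (V := ρ.asModule) K
  let f' : ρ.asModule →ₗ[K] ρ.asModule := f
  -- `f` as an additive map commuting with all module endomorphisms, which are scalars by Schur
  let F : Module.End (Module.End (MonoidAlgebra K H) ρ.asModule) ρ.asModule :=
    { toFun := f'
      map_add' := map_add f'
      map_smul' := by
        intro φ x
        obtain ⟨c, rfl⟩ := schur.2 φ
        exact f'.map_smul c x }
  let b := Module.finBasis K V
  classical
  obtain ⟨a, ha⟩ := jacobson_density F (Finset.univ.image (β := ρ.asModule) b)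
  have hf : f = ρ.asAlgebraHom a := b.ext fun i =>
    ha _ (Finset.mem_image_of_mem _ (Finset.mem_univ i))
  rw [hf]
  refine a.induction_linear (by simp) (fun x y hx hy => ?_) fun g c => ?_
  · rw [map_add]
    exact add_mem hx hy
  · rw [Representation.asAlgebraHom_single]
    exact Submodule.smul_mem _ _ (Submodule.subset_span ⟨g, rfl⟩)

variable {H : Type*} [Group H] {r : ℕ} {E : Type*} [Field E]

theorem IsAbsolutelySimple.ne_zero {ρ : H →* GL (Fin r) E} (hρ : IsAbsolutelySimple ρ) :
    r ≠ 0 := by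
  rintro rfl
  have := (Representation.irreducible_iff_isSimpleModule_asModule _).mp hρ
  have := IsSimpleModule.nontrivial (MonoidAlgebra (AlgebraicClosure E) H)
    (toRepresentation ((Matrix.GeneralLinearGroup.map
      (algebraMap E (AlgebraicClosure E))).comp ρ)).asModule
  exact not_nontrivial (Fin 0 → AlgebraicClosure E) this

/-- A linear form on endomorphisms, given by its coefficients, vanishes if it vanishes on a spanning
family. -/
theorem eq_zero_of_sum_mul_toMatrix'_eq_zero {K ι : Type*} [Field K]
    {f : ι → (Fin r → K) →ₗ[K] (Fin r → K)} (hf : Submodule.span K (Set.range f) = ⊤)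
    {a : Fin r → Fin r → K} (h : ∀ x, ∑ i, ∑ j, a i j * LinearMap.toMatrix' (f x) i j = 0)
    (i j : Fin r) : a i j = 0 := by
  let ψ : ((Fin r → K) →ₗ[K] (Fin r → K)) →ₗ[K] K :=
    { toFun := fun f => ∑ i, ∑ j, a i j * LinearMap.toMatrix' f i j
      map_add' := fun f g => by simp [mul_add, Finset.sum_add_distrib]
      map_smul' := fun c f => by
        simp only [map_smul, Matrix.smul_apply, smul_eq_mul, RingHom.id_apply, Finset.mul_sum,
          mul_left_comm] }
  have hval : ∀ f, ψ f = ∑ i, ∑ j, a i j * LinearMap.toMatrix' f i j := fun f => rfl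
  have hψ : ψ = 0 := LinearMap.ext_on_range hf fun x => h x
  have h2 : ψ (Matrix.toLin' (single i j 1)) = 0 := by rw [hψ]; rfl
  rw [hval, LinearMap.toMatrix'_toLin', Finset.sum_eq_single i, Finset.sum_eq_single j] at h2
  · simpa using h2
  · intro k _ hk
    simp [single_apply_of_col_ne i i hk.symm]
  · simp
  · intro k _ hk
    exact Finset.sum_eq_zero fun l _ => by simp [single_apply_of_row_ne hk.symm]
  · simp

/-- The matrices of an absolutely simple representation span the full matrix algebra already over
the field of definition: a linear form vanishing on them vanishes after extension of scalars. -/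
theorem IsAbsolutelySimple.span_eq_top {ρ : H →* GL (Fin r) E} (hρ : IsAbsolutelySimple ρ) :
    Submodule.span E (Set.range fun h => (ρ h : Matrix (Fin r) (Fin r) E)) = ⊤ := by
  by_contra hne
  obtain ⟨φ, hφ0, hφ⟩ := Submodule.exists_le_ker_of_lt_top _ (lt_top_iff_ne_top.mpr hne)
  apply hφ0
  let K := AlgebraicClosure E
  let ρK := toRepresentation ((Matrix.GeneralLinearGroup.map (algebraMap E K)).comp ρ)
  have : ρK.IsIrreducible := hρ
  have hspan := span_range_eq_top_of_isIrreducible ρK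
  have expand : ∀ X : Matrix (Fin r) (Fin r) E, φ X = ∑ i, ∑ j, φ (single i j 1) * X i j := by
    intro X
    conv_lhs => rw [matrix_eq_sum_single X]
    simp only [map_sum]
    refine Finset.sum_congr rfl fun i _ => Finset.sum_congr rfl fun j _ => ?_
    rw [mul_comm, ← smul_eq_mul, ← map_smul, smul_single, smul_eq_mul, mul_one]
  refine LinearMap.ext fun X => ?_
  rw [expand]
  refine Finset.sum_eq_zero fun i _ => Finset.sum_eq_zero fun j _ => ?_
  have hzero := eq_zero_of_sum_mul_toMatrix'_eq_zero hspan
    (a := fun i j => algebraMap E K (φ (single i j 1))) (fun h => ?_) i j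
  · rw [(map_eq_zero _).mp hzero, zero_mul]
  · have h0 : φ (ρ h) = 0 := hφ (Submodule.subset_span ⟨h, rfl⟩)
    have h1 := congrArg (algebraMap E K) (expand (ρ h))
    rw [h0] at h1
    simp only [map_zero, map_sum, map_mul] at h1
    rw [h1]
    refine Finset.sum_congr rfl fun i _ => Finset.sum_congr rfl fun j _ => ?_
    simp [ρK, toRepresentation]

/-- Schur's lemma for a set of matrices spanning the matrix algebra. -/
theorem exists_eq_scalar_of_commute {ι : Type*} {f : ι → Matrix (Fin r) (Fin r) E}
    (hf : Submodule.span E (Set.range f) = ⊤) {X : Matrix (Fin r) (Fin r) E}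
    (hX : ∀ i, Commute (f i) X) : ∃ c : E, X = scalar (Fin r) c := by
  have key : ∀ Y, Commute Y X := by
    intro Y
    have hY : Y ∈ Submodule.span E (Set.range f) := hf ▸ Submodule.mem_top
    induction hY using Submodule.span_induction with
    | mem Y hY =>
      obtain ⟨i, rfl⟩ := hY
      exact hX i
    | zero => exact Commute.zero_left X
    | add _ _ _ _ h₁ h₂ => exact h₁.add_left h₂
    | smul c _ _ h => exact h.smul_left c
  obtain ⟨c, hc⟩ := mem_range_scalar_of_commute_single fun i j _ => key (single i j 1)
  exact ⟨c, hc.symm⟩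

/-- Two invertible matrices that conjugate a spanning family in the same way differ by a scalar. -/
theorem exists_mul_inv_eq_scalar {ι : Type*} {f : ι → GL (Fin r) E}
    (hspan : Submodule.span E (Set.range fun i => (f i : Matrix (Fin r) (Fin r) E)) = ⊤)
    {A B : GL (Fin r) E} (hAB : ∀ i, A⁻¹ * f i * A = B⁻¹ * f i * B) :
    ∃ c : E, ((A * B⁻¹ : GL (Fin r) E) : Matrix (Fin r) (Fin r) E) = scalar (Fin r) c := by
  refine exists_eq_scalar_of_commute hspan fun i => ?_
  have : f i * (A * B⁻¹) = A * B⁻¹ * f i := by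
    calc f i * (A * B⁻¹) = A * (A⁻¹ * f i * A) * B⁻¹ := by group
      _ = A * B⁻¹ * f i := by rw [hAB]; group
  exact congrArg Units.val this

end Span

/-! ### Gluing homomorphisms -/

section Extend

/-- A homomorphism on a subgroup `U` and one on a normal subgroup `H` that agree on `U ∩ H` and are
compatible with conjugation glue to a homomorphism on `U ⊔ H = U * H`. -/
theorem exists_monoidHom_sup {G L : Type*} [Group G] [Group L] (U H : Subgroup G) [H.Normal]
    (s : G → L) (ρ : H →* L) (hmul : ∀ u ∈ U, ∀ v ∈ U, s (u * v) = s u * s v)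
    (hagree : ∀ h : H, (h : G) ∈ U → s h = ρ h)
    (hconj : ∀ u ∈ U, ∀ h : H, ρ (MulAut.conjNormal u⁻¹ h) = (s u)⁻¹ * ρ h * s u) :
    ∃ f : (U ⊔ H : Subgroup G) →* L,
      ∀ (g : (U ⊔ H : Subgroup G)) (u : G), u ∈ U → ∀ h : H, (g : G) = u * h → f g = s u * ρ h := by
  have hone : s 1 = 1 := by simpa using hmul 1 U.one_mem 1 U.one_mem
  have hinv : ∀ u ∈ U, s u⁻¹ = (s u)⁻¹ := fun u hu => by
    rw [eq_inv_iff_mul_eq_one, ← hmul _ (U.inv_mem hu) _ hu, inv_mul_cancel, hone]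
  have hex : ∀ g : (U ⊔ H : Subgroup G), ∃ p : G × H, p.1 ∈ U ∧ (g : G) = p.1 * p.2 := by
    intro g
    obtain ⟨u, hu, h, hh, e⟩ := Subgroup.mem_sup_of_normal_right.mp g.2
    exact ⟨(u, ⟨h, hh⟩), hu, e.symm⟩
  choose p hpU hp using hex
  have hwd : ∀ u ∈ U, ∀ v ∈ U, ∀ h k : H, u * h = v * k → s u * ρ h = s v * ρ k := by
    intro u hu v hv h k e
    have e' : v⁻¹ * u = ((k * h⁻¹ : H) : G) := by
      rw [Subgroup.coe_mul, Subgroup.coe_inv, eq_mul_inv_iff_mul_eq, mul_assoc, e,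
        inv_mul_cancel_left]
    have hs := hagree (k * h⁻¹) (e' ▸ U.mul_mem (U.inv_mem hv) hu)
    rw [← e', hmul _ (U.inv_mem hv) _ hu, hinv v hv, map_mul, map_inv,
      eq_mul_inv_iff_mul_eq] at hs
    rw [← hs]
    group
  have hval : ∀ (g : (U ⊔ H : Subgroup G)) (u : G), u ∈ U → ∀ h : H, (g : G) = u * h →
      s (p g).1 * ρ (p g).2 = s u * ρ h := fun g u hu h e =>
    hwd _ (hpU g) _ hu _ _ ((hp g).symm.trans e)
  refine ⟨MonoidHom.mk' (fun g => s (p g).1 * ρ (p g).2) fun a b => ?_, hval⟩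
  rw [hval (a * b) ((p a).1 * (p b).1) (U.mul_mem (hpU a) (hpU b))
    (MulAut.conjNormal (p b).1⁻¹ (p a).2 * (p b).2), hmul _ (hpU a) _ (hpU b), map_mul,
    hconj _ (hpU b)]
  · group
  · rw [Subgroup.coe_mul, hp a, hp b]
    simp [mul_assoc]

end Extend

/-! ### The topology of the general linear group -/

section Topology

variable {r : ℕ} {E : Type*} [NormedField E]

/-- Continuity of the inverse comes for free, from Cramer's rule. -/
theorem continuousAt_generalLinearGroup {X : Type*} [TopologicalSpace X] {f : X → GL (Fin r) E}
    {x : X} (hf : ContinuousAt (fun y => (f y : Matrix (Fin r) (Fin r) E)) x) :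
    ContinuousAt f x := by
  have hinv : ContinuousAt (fun y => (f y : Matrix (Fin r) (Fin r) E)⁻¹) x := by
    refine ContinuousAt.comp (f := fun y => (f y : Matrix (Fin r) (Fin r) E))
      (continuousAt_matrix_inv _ ?_) hf
    rw [Ring.inverse_eq_inv']
    exact continuousAt_inv₀ ((Matrix.isUnit_iff_isUnit_det _).mp (f x).isUnit).ne_zero
  rw [ContinuousAt, Units.isInducing_embedProduct.tendsto_nhds_iff]
  refine hf.prodMk_nhds (MulOpposite.continuous_op.continuousAt.comp ?_)
  simpa only [← Matrix.coe_units_inv] using hinv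

/-- Near the identity there is no scalar matrix of finite order dividing `n` but the identity. -/
theorem eventually_eq_one_of_scalar {n : ℕ} (hn : 0 < n) :
    ∀ᶠ A : GL (Fin r) E in 𝓝 1, ∀ c : E, c ^ n = 1 →
      (A : Matrix (Fin r) (Fin r) E) = scalar (Fin r) c → A = 1 := by
  classical
  have hfin : {c : E | c ^ n = 1}.Finite := by
    refine (Polynomial.nthRoots n (1 : E)).toFinset.finite_toSet.subset fun c hc => ?_
    simpa [Polynomial.mem_nthRoots hn] using hc
  let F : Set (GL (Fin r) E) := {A | ∃ c ∈ {c : E | c ^ n = 1},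
    (A : Matrix (Fin r) (Fin r) E) = scalar (Fin r) c}
  have hF : F.Finite := by
    refine Set.Finite.of_finite_image ((hfin.image (scalar (Fin r))).subset ?_)
      (Units.val_injective.injOn (s := F))
    rintro _ ⟨A, ⟨c, hc, hA⟩, rfl⟩
    exact ⟨c, hc, hA.symm⟩
  have hmem := (hF.subset (Set.sdiff_subset (t := {1}))).isClosed.isOpen_compl.mem_nhds
    (x := (1 : GL (Fin r) E)) fun h => h.2 rfl
  filter_upwards [hmem] with A hA c hc hAc
  by_contra hne
  exact hA ⟨⟨c, hc, hAc⟩, hne⟩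

/-- Continuous `n`-th roots near `1` in a finite extension of `ℚ_ℓ`, by the inverse function
theorem. -/
theorem exists_continuousAt_root (ℓ : ℕ) [Fact ℓ.Prime] [NormedAlgebra ℚ_[ℓ] E]
    [FiniteDimensional ℚ_[ℓ] E] {n : ℕ} (hn : n ≠ 0) :
    ∃ f : E → E, ContinuousAt f 1 ∧ f 1 = 1 ∧ ∀ᶠ x in 𝓝 1, f x ^ n = x := by
  have hℓ : (ℓ : ℚ_[ℓ]) ≠ 0 := Nat.cast_ne_zero.mpr (Fact.out : ℓ.Prime).ne_zero
  let : NontriviallyNormedField E := NontriviallyNormedField.ofNormNeOne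
    ⟨algebraMap ℚ_[ℓ] E ℓ, (map_ne_zero _).mpr hℓ, by
      rw [norm_algebraMap', Padic.norm_p]
      exact inv_ne_one.mpr (by exact_mod_cast (Fact.out : ℓ.Prime).one_lt.ne')⟩
  have : CompleteSpace E := FiniteDimensional.complete ℚ_[ℓ] E
  have : CharZero E := charZero_of_injective_algebraMap (algebraMap ℚ_[ℓ] E).injective
  have hd : HasStrictDerivAt (fun x : E => x ^ n) (n * 1 ^ (n - 1)) 1 := hasStrictDerivAt_pow n 1
  have hd0 : (n * 1 ^ (n - 1) : E) ≠ 0 := by simpa using hn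
  refine ⟨hd.localInverse _ _ _ hd0, ?_, ?_, ?_⟩
  · simpa using (hd.to_localInverse hd0).hasDerivAt.continuousAt
  · simpa using (hd.eventually_left_inverse hd0).self_of_nhds
  · simpa using hd.eventually_right_inverse hd0

end Topology

/-! ### Continuous intertwiners -/

section Intertwiner

/-- Recovering `W`, up to a scalar, from the map `v h ↦ W * v h * W'` on a spanning family: if the
matrix unit `single j i 1` equals `∑ c j h • v h`, its image is `∑ c j h • v' h`, and
`∑ j, W * single j i 1 * W' * single i j 1 = (W' i i) • W`. -/
theorem sum_conj_mul_single_eq_smul {r : ℕ} {E : Type*} [Field E] {ι : Type*}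
    {c : Fin r → ι →₀ E} {i : Fin r} {v v' : ι → Matrix (Fin r) (Fin r) E}
    (hc : ∀ j, ((c j).sum fun h a => a • v h) = single j i 1) (W W' : Matrix (Fin r) (Fin r) E)
    (hW : ∀ h, v' h = W * v h * W') :
    ∑ j, ((c j).sum fun h a => a • v' h) * single i j 1 = W' i i • W := by
  have hj : ∀ j, ((c j).sum fun h a => a • v' h) = W * single j i 1 * W' := by
    intro j
    rw [← hc j]
    simp only [Finsupp.sum, Finset.mul_sum, Finset.sum_mul, hW, mul_smul_comm, smul_mul_assoc]
  simp only [hj, mul_assoc]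
  rw [← Finset.mul_sum]
  have : ∀ j, single j i (1 : E) * (W' * single i j 1) = W' i i • single j j 1 := by
    intro j
    rw [← mul_assoc, single_mul_mul_single]
    simp
  simp only [this, ← Finset.smul_sum, sum_single_one, mul_smul_comm, mul_one]

variable {G : Type*} [Group G] {H : Subgroup G} [H.Normal] {r : ℕ} {E : Type*}
variable [TopologicalSpace G] [IsTopologicalGroup G] [NormedField E]

theorem continuous_conjNormal_apply (h : H) :
    Continuous fun g : G => (MulAut.conjNormal g h : H) := by
  refine Continuous.subtype_mk (f := fun g : G => g * (h : G) * g⁻¹) ?_ _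
  fun_prop

/-- Near `1`, intertwiners of determinant `1` between a representation and its conjugates can be
chosen continuously at `1`. -/
theorem exists_local_intertwiner (ℓ : ℕ) [Fact ℓ.Prime] [NormedAlgebra ℚ_[ℓ] E]
    [FiniteDimensional ℚ_[ℓ] E] (hr : r ≠ 0) (ρ : ContRep H r E)
    (hspan : Submodule.span E (Set.range fun h => (ρ h : Matrix (Fin r) (Fin r) E)) = ⊤)
    (hconj : ∀ g : G, ∃ W : GL (Fin r) E, ∀ h, ρ (MulAut.conjNormal g h) = W * ρ h * W⁻¹) :
    ∃ s : G → GL (Fin r) E, ContinuousAt s 1 ∧ s 1 = 1 ∧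
      ∀ᶠ g in 𝓝 (1 : G), (s g).det = 1 ∧ ∀ h, ρ (MulAut.conjNormal g h) = s g * ρ h * (s g)⁻¹ := by
  classical
  let i : Fin r := ⟨0, Nat.pos_of_ne_zero hr⟩
  have hc : ∀ j, ∃ c : H →₀ E, (c.sum fun h a => a • (ρ h : Matrix (Fin r) (Fin r) E)) =
      single j i 1 := fun j =>
    (Finsupp.mem_span_range_iff_exists_finsupp).mp (hspan ▸ Submodule.mem_top)
  choose c hc using hc
  -- a continuous family of intertwiners with `T 1 = 1`, possibly singular away from `1`
  let T : G → Matrix (Fin r) (Fin r) E := fun g =>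
    ∑ j, ((c j).sum fun h a =>
      a • (ρ (MulAut.conjNormal g h) : Matrix (Fin r) (Fin r) E)) * single i j 1
  have hTcont : Continuous T := by
    refine continuous_finsetSum _ fun j _ => Continuous.mul ?_ continuous_const
    refine continuous_finsetSum _ fun h _ => ?_
    refine Continuous.const_smul (g := fun g : G =>
      (ρ (MulAut.conjNormal g h) : Matrix (Fin r) (Fin r) E)) ?_ (c j h)
    exact Units.continuous_val.comp (ρ.continuous_toFun.comp (continuous_conjNormal_apply h))
  have hT1 : T 1 = 1 := by
    have : T 1 = _ := sum_conj_mul_single_eq_smul hc 1 1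
      (v' := fun h => (ρ (MulAut.conjNormal (1 : G) h) : Matrix (Fin r) (Fin r) E))
      (fun h => by simp)
    rw [this]
    simp
  have hTW : ∀ g h, T g * (ρ h : Matrix (Fin r) (Fin r) E) =
      (ρ (MulAut.conjNormal g h) : Matrix (Fin r) (Fin r) E) * T g := by
    intro g h
    obtain ⟨W, hW⟩ := hconj g
    have hTg : T g = _ := sum_conj_mul_single_eq_smul hc W (W⁻¹ : GL (Fin r) E)
      (v' := fun h => (ρ (MulAut.conjNormal g h) : Matrix (Fin r) (Fin r) E))
      (fun h => by rw [hW]; rfl)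
    have : W * ρ h = ρ (MulAut.conjNormal g h) * W := by rw [hW]; group
    rw [hTg, smul_mul_assoc, mul_smul_comm]
    exact congrArg _ (congrArg Units.val this)
  obtain ⟨f, hfcont, hf1, hf⟩ := exists_continuousAt_root (E := E) ℓ hr
  have hdet : ContinuousAt (fun g => (T g).det) 1 := hTcont.matrix_det.continuousAt
  have hdet1 : (T 1).det = 1 := by rw [hT1, det_one]
  have hfdet : ContinuousAt (fun g => f (T g).det) 1 :=
    ContinuousAt.comp (f := fun g => (T g).det) (by rwa [hdet1]) hdet
  have hfdet1 : f (T 1).det = 1 := by rw [hdet1, hf1]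
  let S : G → Matrix (Fin r) (Fin r) E := fun g => (f (T g).det)⁻¹ • T g
  have hScont : ContinuousAt S 1 :=
    (hfdet.inv₀ (by rw [hfdet1]; exact one_ne_zero)).smul hTcont.continuousAt
  have hS1 : S 1 = 1 := by
    change (f (T 1).det)⁻¹ • T 1 = 1
    rw [hfdet1, hT1, inv_one, one_smul]
  have hSdet : ∀ᶠ g in 𝓝 (1 : G), (S g).det = 1 := by
    have e1 : ∀ᶠ g in 𝓝 (1 : G), (T g).det ≠ 0 :=
      hdet.eventually_ne (by rw [hdet1]; exact one_ne_zero)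
    have e2 : ∀ᶠ g in 𝓝 (1 : G), f (T g).det ^ r = (T g).det :=
      hdet.eventually (p := fun x => f x ^ r = x) (by simpa only [hdet1] using hf)
    filter_upwards [e1, e2] with g h1 h2
    rw [det_smul, Fintype.card_fin, inv_pow, h2, inv_mul_cancel₀ h1]
  -- the default value `1` is only used outside a neighbourhood of `1`
  let s : G → GL (Fin r) E := fun g =>
    if hg : (S g).det = 1 then GeneralLinearGroup.mkOfDetNeZero (S g) (hg ▸ one_ne_zero) else 1
  have hs : ∀ g, (S g).det = 1 → (s g : Matrix (Fin r) (Fin r) E) = S g := fun g hg => by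
    simp only [s, dif_pos hg]
    rfl
  refine ⟨s, continuousAt_generalLinearGroup (hScont.congr ?_), ?_, ?_⟩
  · filter_upwards [hSdet] with g hg using (hs g hg).symm
  · exact Units.ext ((hs 1 hSdet.self_of_nhds).trans hS1)
  · filter_upwards [hSdet] with g hg
    refine ⟨Units.ext ((congrArg det (hs g hg)).trans hg), fun h => ?_⟩
    rw [eq_mul_inv_iff_mul_eq]
    refine Units.ext ?_
    rw [Units.val_mul, Units.val_mul, hs g hg]
    simp only [S, smul_mul_assoc, mul_smul_comm, hTW]

end Intertwiner

/-! ### Extensions with finite determinant -/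

section Extension

variable {G : Type*} [Group G] [TopologicalSpace G] [IsTopologicalGroup G] {H : Subgroup G}
  {r : ℕ} {E : Type*} [NormedField E]

theorem HasFiniteDet.exists_pow_det_eq_one {K : Type*} [Group K] {ρ : K →* GL (Fin r) E}
    (hρ : HasFiniteDet ρ) : ∃ n : ℕ, 0 < n ∧ ∀ k, (ρ k).det ^ n = 1 := by
  let δ : K →* Eˣ := Matrix.GeneralLinearGroup.det.comp ρ
  have : Finite δ.range := hρ
  exact ⟨Nat.card δ.range, Nat.card_pos, fun k =>
    congrArg Subtype.val (pow_card_eq_one' (x := (⟨δ k, k, rfl⟩ : δ.range)))⟩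

/-- A scalar matrix whose determinant is a root of unity is itself of finite order. -/
theorem pow_eq_one_of_eq_scalar {n : ℕ} {A : GL (Fin r) E} (hA : A.det ^ n = 1) {c : E}
    (hc : (A : Matrix (Fin r) (Fin r) E) = scalar (Fin r) c) : c ^ (r * n) = 1 := by
  have h := congrArg Units.val hA
  rw [Units.val_pow_eq_pow_val, GeneralLinearGroup.val_det_apply, hc] at h
  simpa [pow_mul] using h

/-- Two extensions of a representation with spanning image restrict to conjugation by `H` in the
same way, so they differ by scalars; these are roots of unity of bounded order, hence trivial near
the identity. -/
theorem exists_open_subgroup_eq [H.Normal] (hr : r ≠ 0) {ρH : ContRep H r E}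
    (hspan : Submodule.span E (Set.range fun h => (ρH h : Matrix (Fin r) (Fin r) E)) = ⊤)
    {G₁ G₂ : Subgroup G} (h₁ : H ≤ G₁) (h₂ : H ≤ G₂) {ρ₁ : ContRep G₁ r E} {ρ₂ : ContRep G₂ r E}
    (hG₁ : IsOpen (G₁ : Set G)) (hG₂ : IsOpen (G₂ : Set G))
    (he₁ : IsFiniteDetExtension ρH G₁ h₁ ρ₁) (he₂ : IsFiniteDetExtension ρH G₂ h₂ ρ₂) :
    ∃ (G₃ : Subgroup G) (h₃₁ : G₃ ≤ G₁) (h₃₂ : G₃ ≤ G₂),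
      H ≤ G₃ ∧ IsOpen (G₃ : Set G) ∧
      ∀ g : G₃, ρ₁ (Subgroup.inclusion h₃₁ g) = ρ₂ (Subgroup.inclusion h₃₂ g) := by
  let D : Subgroup G := G₁ ⊓ G₂
  let σ₁ : D →* GL (Fin r) E := ρ₁.toMonoidHom.comp (Subgroup.inclusion inf_le_left)
  let σ₂ : D →* GL (Fin r) E := ρ₂.toMonoidHom.comp (Subgroup.inclusion inf_le_right)
  have hσ₁ : Continuous σ₁ := ρ₁.continuous_toFun.comp (continuous_inclusion inf_le_left)
  have hσ₂ : Continuous σ₂ := ρ₂.continuous_toFun.comp (continuous_inclusion inf_le_right)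
  have hD : IsOpen (D : Set G) := hG₁.inter hG₂
  have hHD : H ≤ D := le_inf h₁ h₂
  have hσH₁ : ∀ h : H, σ₁ (Subgroup.inclusion hHD h) = ρH h := he₁.1
  have hσH₂ : ∀ h : H, σ₂ (Subgroup.inclusion hHD h) = ρH h := he₂.1
  obtain ⟨n₁, hn₁, hd₁⟩ := he₁.2.exists_pow_det_eq_one
  obtain ⟨n₂, hn₂, hd₂⟩ := he₂.2.exists_pow_det_eq_one
  have hcont : Tendsto (fun g => σ₁ g * (σ₂ g)⁻¹) (𝓝 1) (𝓝 1) := by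
    have h : Tendsto (fun g => σ₁ g * (σ₂ g)⁻¹) (𝓝 1) (𝓝 (σ₁ 1 * (σ₂ 1)⁻¹)) :=
      (hσ₁.mul hσ₂.inv).tendsto 1
    rwa [map_one, map_one, inv_one, mul_one] at h
  have hnear : ∀ᶠ g in 𝓝 (1 : D), σ₁ g = σ₂ g := by
    filter_upwards [hcont.eventually (eventually_eq_one_of_scalar
      (Nat.mul_pos (Nat.pos_of_ne_zero hr) (Nat.mul_pos hn₁ hn₂)))] with g hg
    obtain ⟨c, hc⟩ := exists_mul_inv_eq_scalar hspan (A := σ₁ g) (B := σ₂ g) fun h => by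
      have e : Subgroup.inclusion hHD (MulAut.conjNormal (g : G)⁻¹ h) =
          g⁻¹ * Subgroup.inclusion hHD h * g := by ext; simp
      have e₁ := hσH₁ (MulAut.conjNormal (g : G)⁻¹ h)
      have e₂ := hσH₂ (MulAut.conjNormal (g : G)⁻¹ h)
      rw [e, map_mul, map_mul, map_inv, hσH₁] at e₁
      rw [e, map_mul, map_mul, map_inv, hσH₂] at e₂
      exact e₁.trans e₂.symm
    refine mul_inv_eq_one.mp (hg c (pow_eq_one_of_eq_scalar ?_ hc) hc)
    have e₁ : (σ₁ g).det ^ n₁ = 1 := hd₁ _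
    have e₂ : (σ₂ g).det ^ n₂ = 1 := hd₂ _
    rw [map_mul, map_inv, mul_pow, inv_pow, pow_mul, e₁, mul_comm n₁, pow_mul, e₂]
    simp
  have hopen : IsOpen ((σ₁.eqLocus σ₂ : Subgroup D) : Set D) :=
    Subgroup.isOpen_of_mem_nhds _ (g := 1) hnear
  refine ⟨(σ₁.eqLocus σ₂).map D.subtype, ?_, ?_, fun h hh => ?_, ?_, ?_⟩
  · exact (Subgroup.map_subtype_le _).trans inf_le_left
  · exact (Subgroup.map_subtype_le _).trans inf_le_right
  · exact ⟨⟨h, hHD hh⟩, (hσH₁ ⟨h, hh⟩).trans (hσH₂ ⟨h, hh⟩).symm, rfl⟩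
  · exact hD.isOpenMap_subtype_val _ hopen
  · rintro ⟨_, g, hg, rfl⟩
    exact hg

/-- A continuous choice of intertwiners of determinant `1` is multiplicative, and agrees with the
given representation, up to roots of unity of bounded order, so exactly on a small open
subgroup. -/
theorem exists_open_extension [CompactSpace G] [TotallyDisconnectedSpace G] [H.Normal]
    (ℓ : ℕ) [Fact ℓ.Prime] [NormedAlgebra ℚ_[ℓ] E] [FiniteDimensional ℚ_[ℓ] E] (hr : r ≠ 0)
    {ρH : ContRep H r E}
    (hspan : Submodule.span E (Set.range fun h => (ρH h : Matrix (Fin r) (Fin r) E)) = ⊤)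
    (hdet : HasFiniteDet ρH.toMonoidHom)
    (hconj : ∀ g : G, ∃ W : GL (Fin r) E, ∀ h, ρH (MulAut.conjNormal g h) = W * ρH h * W⁻¹) :
    ∃ (G' : Subgroup G) (hG' : H ≤ G') (ρ : ContRep G' r E),
      IsOpen (G' : Set G) ∧ IsFiniteDetExtension ρH G' hG' ρ := by
  obtain ⟨s, hs, hs1, hsnear⟩ := exists_local_intertwiner ℓ hr ρH hspan hconj
  obtain ⟨n, hn, hdn⟩ := hdet.exists_pow_det_eq_one
  have hsmall := eventually_eq_one_of_scalar (r := r) (E := E)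
    (Nat.mul_pos (Nat.pos_of_ne_zero hr) hn)
  have hs' : Tendsto s (𝓝 1) (𝓝 1) := by simpa only [ContinuousAt, hs1] using hs
  have hmul : Tendsto (fun p : G × G => s (p.1 * p.2) * (s p.1 * s p.2)⁻¹)
      (𝓝 1 ×ˢ 𝓝 1) (𝓝 1) := by
    have h1 : Tendsto (fun p : G × G => p.1 * p.2) (𝓝 1 ×ˢ 𝓝 1) (𝓝 1) := by
      have := (continuous_mul (M := G)).tendsto (1, 1)
      rwa [nhds_prod_eq, mul_one] at this
    have := (hs'.comp h1).mul ((hs'.comp tendsto_fst).mul (hs'.comp tendsto_snd)).inv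
    simpa using this
  have hres : Tendsto (fun h : H => s h * (ρH h)⁻¹) (𝓝 1) (𝓝 1) := by
    have h1 : Tendsto (fun h : H => (h : G)) (𝓝 1) (𝓝 1) := continuous_subtype_val.tendsto 1
    have h2 : Tendsto ρH (𝓝 1) (𝓝 1) := by
      have := ρH.continuous_toFun.tendsto 1
      rwa [show ρH.toFun 1 = 1 from map_one ρH] at this
    have := (hs'.comp h1).mul h2.inv
    simpa using this
  -- both defects, of multiplicativity and of agreement with `ρH`, are trivial once small
  obtain ⟨V₁, hV₁, hmul'⟩ := eventually_prod_self_iff'.mp (hmul.eventually hsmall)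
  obtain ⟨V₂, hV₂, hres'⟩ := (mem_nhds_subtype _ _ _).mp (hres.eventually hsmall)
  obtain ⟨V, hV, hVo, hV1⟩ := mem_nhds_iff.mp (inter_mem (inter_mem hV₁ hV₂) hsnear)
  obtain ⟨U, hU⟩ := ProfiniteGrp.exist_openNormalSubgroup_sub_open_nhds_of_one hVo hV1
  have hUo : IsOpen (U : Set G) := U.toOpenSubgroup.isOpen
  have hUV : ∀ u ∈ U.toSubgroup, u ∈ V₁ ∧ u ∈ V₂ ∧ (s u).det = 1 ∧
      ∀ h, ρH (MulAut.conjNormal u h) = s u * ρH h * (s u)⁻¹ := fun u hu => by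
    obtain ⟨⟨a, b⟩, c⟩ := hV (hU hu)
    exact ⟨a, b, c⟩
  have hc : ∀ u ∈ U.toSubgroup, ∀ h,
      ρH (MulAut.conjNormal u⁻¹ h) = (s u)⁻¹ * ρH h * s u := by
    intro u hu h
    have := (hUV u hu).2.2.2 (MulAut.conjNormal u⁻¹ h)
    rw [show MulAut.conjNormal u (MulAut.conjNormal u⁻¹ h) = h by simp] at this
    rw [this]
    group
  have hUmul : ∀ u ∈ U.toSubgroup, ∀ v ∈ U.toSubgroup, s (u * v) = s u * s v := by
    intro u hu v hv
    have huv := U.toSubgroup.mul_mem hu hv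
    obtain ⟨c, hsc⟩ := exists_mul_inv_eq_scalar hspan (A := s (u * v)) (B := s u * s v)
      fun h => by
        rw [← hc _ huv]
        have := hc v hv (MulAut.conjNormal u⁻¹ h)
        rw [hc u hu] at this
        rw [_root_.mul_inv_rev, map_mul, MulAut.mul_apply, this]
        group
    refine mul_inv_eq_one.mp
      (hmul' u (hUV u hu).1 v (hUV v hv).1 c (pow_eq_one_of_eq_scalar ?_ hsc) hsc)
    rw [map_mul, map_inv, map_mul, (hUV _ huv).2.2.1, (hUV _ hu).2.2.1, (hUV _ hv).2.2.1]
    simp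
  have hUres : ∀ h : H, (h : G) ∈ U.toSubgroup → s h = ρH h := by
    intro h hh
    obtain ⟨c, hsc⟩ := exists_mul_inv_eq_scalar hspan (A := s h) (B := ρH h) fun k => by
      rw [← hc _ hh, show MulAut.conjNormal (h : G)⁻¹ k = h⁻¹ * k * h by ext; simp,
        map_mul, map_mul, map_inv]
    refine mul_inv_eq_one.mp (hres' (hUV _ hh).2.1 c (pow_eq_one_of_eq_scalar ?_ hsc) hsc)
    have := hdn h
    rw [map_mul, map_inv, (hUV _ hh).2.2.1, one_mul, inv_pow]
    exact inv_eq_one.mpr this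
  obtain ⟨f, hf⟩ := exists_monoidHom_sup U.toSubgroup H s ρH.toMonoidHom hUmul hUres hc
  have hfU : ∀ g : (U.toSubgroup ⊔ H : Subgroup G), (g : G) ∈ U.toSubgroup → f g = s g := by
    intro g hg
    simpa using hf g g hg 1 (by simp)
  have hfH : ∀ h : H, f (Subgroup.inclusion le_sup_right h) = ρH h := by
    intro h
    simpa [hs1] using hf (Subgroup.inclusion le_sup_right h) 1 U.toSubgroup.one_mem h (by simp)
  have hfcont : Continuous f := by
    refine continuous_of_continuousAt_one f ?_
    have h1 : Tendsto (fun g : (U.toSubgroup ⊔ H : Subgroup G) => (g : G)) (𝓝 1) (𝓝 1) :=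
      continuous_subtype_val.tendsto 1
    rw [ContinuousAt, map_one]
    refine (hs'.comp h1).congr' ?_
    filter_upwards [h1.eventually (hUo.mem_nhds U.toSubgroup.one_mem)] with g hg
      using (hfU g hg).symm
  refine ⟨U.toSubgroup ⊔ H, le_sup_right, ⟨f, hfcont⟩,
    Subgroup.isOpen_mono le_sup_left hUo, hfH, ?_⟩
  refine Set.Finite.subset hdet ?_
  rintro _ ⟨g, rfl⟩
  obtain ⟨u, hu, h, hh, e⟩ := Subgroup.mem_sup_of_normal_right.mp g.2
  refine ⟨⟨h, hh⟩, ?_⟩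
  have : f g = s u * ρH ⟨h, hh⟩ := hf g u hu ⟨h, hh⟩ e.symm
  change (ρH ⟨h, hh⟩).det = (f g).det
  rw [this, map_mul, (hUV u hu).2.2.1, one_mul]

end Extension

end ProfiniteExt

open ProfiniteExt in
theorem propositionB2
    {G : Type*} [Group G] [TopologicalSpace G] [IsTopologicalGroup G] [CompactSpace G]
    [T2Space G] [TotallyDisconnectedSpace G]
    (H : Subgroup G) [H.Normal] (hH : IsClosed (H : Set G))
    (ℓ : ℕ) [Fact ℓ.Prime]
    {E : Type*} [NormedField E] [NormedAlgebra ℚ_[ℓ] E] [FiniteDimensional ℚ_[ℓ] E]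
    (r : ℕ) (ρH : ContRep H r E)
    (hsimple : IsAbsolutelySimple ρH.toMonoidHom)
    (hdet : HasFiniteDet ρH.toMonoidHom)
    (hfix : ∀ γ : G ⧸ H, quotientAction H r E γ (isoClass ρH) = isoClass ρH) :
    -- existence of an extension over some open subgroup containing `H`
    (∃ (G' : Subgroup G) (hG' : H ≤ G') (ρ : ContRep G' r E),
      IsOpen (G' : Set G) ∧ IsFiniteDetExtension ρH G' hG' ρ) ∧
    -- any two such extensions agree over a smaller open subgroup containing `H`
    (∀ (G₁ G₂ : Subgroup G) (h₁ : H ≤ G₁) (h₂ : H ≤ G₂)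
      (ρ₁ : ContRep G₁ r E) (ρ₂ : ContRep G₂ r E),
      IsOpen (G₁ : Set G) → IsOpen (G₂ : Set G) →
      IsFiniteDetExtension ρH G₁ h₁ ρ₁ → IsFiniteDetExtension ρH G₂ h₂ ρ₂ →
      ∃ (G₃ : Subgroup G) (h₃₁ : G₃ ≤ G₁) (h₃₂ : G₃ ≤ G₂),
        H ≤ G₃ ∧ IsOpen (G₃ : Set G) ∧
        ∀ g : G₃, ρ₁ (Subgroup.inclusion h₃₁ g) = ρ₂ (Subgroup.inclusion h₃₂ g)) := by
  have hr := hsimple.ne_zero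
  have hspan := hsimple.span_eq_top
  refine ⟨exists_open_extension ℓ hr hspan hdet fun g => ?_, ?_⟩
  · have hg : isoClass (conjRep H g⁻¹ ρH) = isoClass ρH := hfix ((g⁻¹ : G) : G ⧸ H)
    obtain ⟨W, hW⟩ := Quotient.exact hg
    refine ⟨W⁻¹, fun h => ?_⟩
    have hWh : ρH h = W * ρH (MulAut.conjNormal (g⁻¹)⁻¹ h) * W⁻¹ := hW h
    rw [inv_inv] at hWh
    rw [hWh]
    group
  · intro G₁ G₂ h₁ h₂ ρ₁ ρ₂ hG₁ hG₂ he₁ he₂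
    exact exists_open_subgroup_eq hr hspan h₁ h₂ hG₁ hG₂ he₁ he₂
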